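/- Let $Y$ be a simply connected, 1-ended, locally finite (Hausdorff) CW complex of dimension at most $2$, and let $J$ be a finitely generated group acting on $Y$ by cell-preserving covering transformations; that is, every element of $J$ acts as a homeomorphism mapping each open cell onto an open cell of the same dimension, and every point of $Y$ has a neighbourhood whose translates under the elements of $J$ are pairwise disjoint. Let $p:Y\to J\backslash Y$ be the quotient map. Here 1-ended means that for every compact $K\subset Y$ exactly one connected component of $Y-K$ is not contained in a compact subset of $Y$. Let $D$ be a (non-empty) connected finite subcomplex of $Y$ such that, for a base point $x\in p(D)$, the image of $\pi_1(p(D),x)$ in $\pi_1(J\backslash Y,x)$ under the homomorphism induced by the inclusion $p(D)\hookrightarrow J\backslash Y$ generates $\pi_1(J\backslash Y,x)$. Write $J\cdot A=\bigcup_{g\in J}gA$ for $A\subset Y$. Let $V$ be a connected component of $Y-J\cdot D$ that is $J$-unbounded, i.e. there is no compact $K\subset Y$ with $V\subset J\cdot K$. Then the stabilizer $\{g\in J: gV=V\}$ is a finitely generated group. -/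

import Mathlib

open Topology Set
open scoped Pointwise

namespace CoveringAction

section General

variable {Y : Type*} [TopologicalSpace Y]

/-- `V` is a connected component of the subspace `F` of `Y`. -/
def IsComponentOf (V F : Set Y) : Prop :=
  ∃ y ∈ F, V = connectedComponentIn F y

/-- A subset of `Y` is bounded if it is contained in a compact subset of `Y`. -/
def BoundedSubset (S : Set Y) : Prop :=
  ∃ K : Set Y, IsCompact K ∧ S ⊆ K

/-- `Y` is 1-ended: the complement of every compact subset has exactly one unbounded component. -/
def OneEnded (Y : Type*) [TopologicalSpace Y] : Prop :=
  ∀ K : Set Y, IsCompact K → ∃! V : Set Y, IsComponentOf V Kᶜ ∧ ¬ BoundedSubset V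

end General

section CW

variable (Y : Type*) [TopologicalSpace Y] [CWComplex (univ : Set Y)]

/-- The CW complex `Y` is locally finite: every point has a neighbourhood that meets only finitely
many closed cells. -/
def LocallyFiniteCW : Prop :=
  LocallyFinite fun c : Σ n, RelCWComplex.cell (univ : Set Y) n => RelCWComplex.closedCell c.1 c.2

/-- The CW complex `Y` has no cells of dimension greater than `d`. -/
def DimensionLE (d : ℕ) : Prop :=
  ∀ n : ℕ, d < n → IsEmpty (RelCWComplex.cell (univ : Set Y) n)

end CW

section Action

variable (J : Type*) [Group J] {Y : Type*} [TopologicalSpace Y] [MulAction J Y]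

/-- Every element of `J` maps every open cell of `Y` onto an open cell of the same dimension. -/
def CellPreserving (J : Type*) [Group J] (Y : Type*) [TopologicalSpace Y] [MulAction J Y]
    [CWComplex (univ : Set Y)] : Prop :=
  ∀ (g : J) (n : ℕ) (i : RelCWComplex.cell (univ : Set Y) n),
    ∃ j : RelCWComplex.cell (univ : Set Y) n,
      g • (RelCWComplex.openCell n i : Set Y) = RelCWComplex.openCell n j

/-- The quotient map `p : Y → J\Y`. -/
def proj (y : Y) : MulAction.orbitRel.Quotient J Y :=
  Quotient.mk (MulAction.orbitRel J Y) y

/-- The group `J` acts on `Y` as covering transformations: it acts by homeomorphisms and every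
point of `Y` has a neighbourhood whose translates by the elements of `J` are pairwise disjoint, so
that `p : Y → J\Y` is a covering map with the elements of `J` as deck transformations. -/
def ActsByCoveringTransformations (J : Type*) [Group J] (Y : Type*) [TopologicalSpace Y]
    [MulAction J Y] : Prop :=
  IsQuotientCoveringMap (proj J : Y → MulAction.orbitRel.Quotient J Y) J

/-- The union `J · A` of all translates of `A`. -/
def translates (A : Set Y) : Set Y :=
  ⋃ g : J, g • A

/-- A subset `S` of `Y` is `J`-unbounded if it is not contained in `J · K` for any compact `K`. -/
def JUnbounded (S : Set Y) : Prop :=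
  ¬ ∃ K : Set Y, IsCompact K ∧ S ⊆ translates J K

end Action

/-- For a subset `A` of a space `X` and a base point `x` in `A`, the image of `π₁(A, x)` under the
map induced by the inclusion of `A` in `X` generates `π₁(X, x)`. -/
def PiOneImageGenerates {X : Type*} [TopologicalSpace X] (A : Set X) (x : A) : Prop :=
  Subgroup.closure
      (range (FundamentalGroup.map (⟨Subtype.val, continuous_subtype_val⟩ : C(A, X)) x)) = ⊤

end CoveringAction

/-! Write `A = J · D`. Since `π₁(p(D))` generates `π₁(J\Y)`, loops in `p(D)` lift to paths in `A`
joining the translates of `D`, so `A` is connected. It is also closed. A connected open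
neighbourhood `W` of `D` meeting finitely many cells gives a connected open neighbourhood `N = J ·
W` of `A`. The key point is that `V ∩ N` is connected. The sets `V` and `N ∪ Vᶜ` are connected, open
and cover the simply connected `Y`, and such a pair has connected intersection; otherwise it would
glue to a nontrivial double cover of `Y` (`SimplyConnectedSpace.isPreconnected_inter`). The
stabilizer of `V` acts on `V ∩ N`, which is the union of its translates of one open set `U`, a
finite union of sets `k⁻¹ • W ∩ V`. Only finitely many elements move `U` to meet itself, and these
generate (`Group.fg_of_isPreconnected_iUnion_smul`). -/

/-! ### Connected intersections in simply connected spaces -/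

/-- The double cover of a space glued from trivial double covers of two open sets `U` and `V`
covering it, the sheets being interchanged where `c` is true. -/
noncomputable def doubleCoverCore {Y : Type*} [TopologicalSpace Y] {U V : Set Y}
    (hU : IsOpen U) (hV : IsOpen V) (hUV : U ∪ V = univ) (c : Y → Bool)
    (hc : ContinuousOn c (U ∩ V)) : FiberBundleCore Bool Y Bool where
  baseSet i := if i then U else V
  isOpen_baseSet i := by cases i <;> simpa
  indexAt y := open Classical in decide (y ∈ U)
  mem_baseSet_at y := by
    have : y ∈ U ∪ V := hUV ▸ mem_univ y
    by_cases h : y ∈ U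
    · simp [h]
    · simpa [h] using this
  coordChange i j y v := ((i ^^ j) && c y) ^^ v
  coordChange_self i y _ v := by simp
  continuousOn_coordChange i j := by
    have key : ∀ s : Set (Y × Bool), (∀ p ∈ s, p.1 ∈ U ∩ V) →
        ContinuousOn (fun p : Y × Bool => c p.1 ^^ p.2) s := fun s hs => by
      have h1 : ContinuousOn (fun p : Y × Bool => (c p.1, p.2)) s :=
        (hc.comp continuousOn_fst hs).prodMk continuousOn_snd
      exact (continuous_of_discreteTopology (f := fun q : Bool × Bool => q.1 ^^ q.2)).comp_continuousOn h1
    cases i <;> cases j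
    · simpa using continuousOn_snd
    · simpa using key _ fun p hp => by simpa [and_comm] using hp
    · simpa using key _ fun p hp => by simpa using hp
    · simpa using continuousOn_snd
  coordChange_comp i j k y _ v := by
    cases i <;> cases j <;> cases k <;> simp

/-- If a simply connected, locally path connected space is the union of two connected open sets,
then the intersection of these is connected. -/
theorem SimplyConnectedSpace.isPreconnected_inter {Y : Type*} [TopologicalSpace Y]
    [SimplyConnectedSpace Y] [LocallyPathConnectedSpace Y] {U V : Set Y}
    (hU : IsOpen U) (hV : IsOpen V) (hUc : IsPreconnected U) (hVc : IsPreconnected V)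
    (hUV : U ∪ V = univ) : IsPreconnected (U ∩ V) := by
  refine isPreconnected_of_forall_constant fun c hc x hx y hy => ?_
  let Z := doubleCoverCore hU hV hUV c hc
  have hcov : IsCoveringMap Z.proj := FiberBundle.isCoveringMap
  -- Simple connectivity enters here: the identity of `Y` lifts to a global section of the double
  -- cover.
  obtain ⟨F, ⟨-, hF⟩, -⟩ := hcov.existsUnique_continuousMap_lifts (ContinuousMap.id Y) x
    (⟨x, true⟩ : Z.TotalSpace) rfl
  have hF' (z : Y) : (F z).1 = z := congrFun hF z
  -- Over each of the two connected sets, the sheet chosen by the section is constant. By `hchange`,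
  -- `c` is the difference of these two constants.
  have hconst (i : Bool) (hi : IsPreconnected (Z.baseSet i)) {a b : Y} (ha : a ∈ Z.baseSet i)
      (hb : b ∈ Z.baseSet i) : (Z.localTriv i (F a)).2 = (Z.localTriv i (F b)).2 := by
    refine hi.constant (f := fun z => (Z.localTriv i (F z)).2) ?_ ha hb
    refine continuous_snd.comp_continuousOn ?_
    refine (Z.localTriv i).continuousOn_toFun.comp F.continuous.continuousOn fun z hz => ?_
    rw [← (hF' z : (F z).1 = z)] at hz
    exact hz
  have hchange {a : Y} (ha : a ∈ U ∩ V) :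
      (Z.localTriv false (F a)).2 = (c a ^^ (Z.localTriv true (F a)).2) := by
    have haU : (F a).1 ∈ Z.baseSet true := by
      rw [(hF' a : (F a).1 = a)]
      exact ha.1
    have haV : (F a).1 ∈ Z.baseSet false := by
      rw [(hF' a : (F a).1 = a)]
      exact ha.2
    have := Z.coordChange_comp (Z.indexAt (F a).1) true false (F a).1
      ⟨⟨Z.mem_baseSet_at _, haU⟩, haV⟩ (F a).2
    rw [Z.localTriv_apply, Z.localTriv_apply]
    refine this.symm.trans ?_
    change ((true ^^ false) && c (F a).1 ^^ _) = _
    rw [hF' a]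
    simp
  have h1 := hchange hx
  rw [hconst false hVc hx.2 hy.2, hconst true hUc hx.1 hy.1, hchange hy] at h1
  simpa using h1.symm

/-! ### Local path connectedness of CW complexes -/

open RelCWComplex in
/-- A Hausdorff CW complex is locally path connected. -/
theorem CWComplex.locallyPathConnectedSpace (Y : Type*) [TopologicalSpace Y] [T2Space Y]
    [CWComplex (univ : Set Y)] : LocallyPathConnectedSpace Y := by
  let f : (Σ c : Σ n, cell (univ : Set Y) n,
      Metric.closedBall (0 : Fin c.1 → ℝ) 1) → Y := fun z => RelCWComplex.map z.1.1 z.1.2 z.2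
  have hf (c : Σ n, cell (univ : Set Y) n) : Continuous fun z => f ⟨c, z⟩ :=
    (RelCWComplex.continuousOn c.1 c.2).domRestrict
  have (c : Σ n, cell (univ : Set Y) n) :
      LocallyPathConnectedSpace (Metric.closedBall (0 : Fin c.1 → ℝ) 1) :=
    (convex_closedBall _ _).locallyPathConnectedSpace
  -- The characteristic maps present `Y` as a quotient of a disjoint union of closed balls, and
  -- local path connectedness passes to quotients.
  refine IsQuotientMap.locallyPathConnectedSpace (f := f) ?_
  rw [isQuotientMap_iff_isClosed]
  refine ⟨fun y => ?_, fun s => ⟨fun hs => hs.preimage (continuous_sigma hf), fun hs => ?_⟩⟩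
  · have : y ∈ ⋃ (n : ℕ) (j : cell (univ : Set Y) n), closedCell n j := by
      rw [CWComplex.union]
      exact mem_univ y
    simp only [mem_iUnion] at this
    obtain ⟨n, j, z, hz, rfl⟩ := this
    exact ⟨⟨⟨n, j⟩, z, hz⟩, rfl⟩
  · rw [CWComplex.closed univ s (subset_univ _)]
    intro n j
    have hK : IsCompact ((fun z => f ⟨⟨n, j⟩, z⟩) ⁻¹' s) :=
      (isClosed_sigma_iff.1 hs ⟨n, j⟩).isCompact
    convert (hK.image (hf ⟨n, j⟩)).isClosed using 1
    ext y
    constructor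
    · rintro ⟨hy, z, hz, rfl⟩
      exact ⟨⟨z, hz⟩, hy, rfl⟩
    · rintro ⟨z, hz, rfl⟩
      exact ⟨hz, z, z.2, rfl⟩

/-! ### A criterion for finite generation -/

/-- A group acting by homeomorphisms is generated by the elements moving an open set `U` to a set
that meets `U`, if the union of the translates of `U` is connected. -/
theorem Group.fg_of_isPreconnected_iUnion_smul {G Y : Type*} [Group G] [TopologicalSpace Y]
    [MulAction G Y] [ContinuousConstSMul G Y] {U : Set Y} (hU : IsOpen U) (hne : U.Nonempty)
    (hconn : IsPreconnected (⋃ g : G, g • U)) (hfin : {g : G | (g • U ∩ U).Nonempty}.Finite) :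
    Group.FG G := by
  rw [Group.fg_iff]
  refine ⟨_, ?_, hfin⟩
  set H := Subgroup.closure {g : G | (g • U ∩ U).Nonempty}
  rw [Subgroup.eq_top_iff']
  by_contra! ⟨k, hk⟩
  obtain ⟨u, hu⟩ := hne
  -- Translates by elements of `H` and by elements outside `H` form two open sets. A common point of
  -- `g • U` and `g' • U` puts `g⁻¹ * g'` among the generators.
  obtain ⟨z, -, hz1, hz2⟩ := hconn (⋃ g ∈ H, g • U) (⋃ g ∉ H, g • U)
    (isOpen_biUnion fun g _ => hU.smul g) (isOpen_biUnion fun g _ => hU.smul g)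
    (iUnion_subset fun g => by
      by_cases hg : g ∈ H
      · exact subset_union_of_subset_left (subset_biUnion_of_mem (u := fun g : G => g • U) hg) _
      · exact subset_union_of_subset_right
          (subset_biUnion_of_mem (s := {g | g ∉ H}) (u := fun g : G => g • U) hg) _)
    ⟨u, mem_iUnion.2 ⟨1, by simpa⟩, mem_iUnion₂.2 ⟨1, H.one_mem, by simpa⟩⟩
    ⟨k • u, mem_iUnion.2 ⟨k, smul_mem_smul_set hu⟩, mem_iUnion₂.2 ⟨k, hk, smul_mem_smul_set hu⟩⟩
  simp only [mem_iUnion] at hz1 hz2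
  obtain ⟨g, hg, hzg⟩ := hz1
  obtain ⟨g', hg', hzg'⟩ := hz2
  refine hg' ?_
  have : g⁻¹ * g' ∈ H := Subgroup.subset_closure
    ⟨g⁻¹ • z, by rw [mul_smul]; exact smul_mem_smul_set hzg', by rwa [← mem_smul_set_iff_inv_smul_mem]⟩
  simpa using H.mul_mem hg this

/-! ### Components of the complement of a closed set -/

namespace CoveringAction

section Component

variable {Y : Type*} [TopologicalSpace Y] {V V' F : Set Y}

theorem IsComponentOf.isPreconnected (h : IsComponentOf V F) : IsPreconnected V := by
  obtain ⟨y, -, rfl⟩ := h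
  exact isPreconnected_connectedComponentIn

theorem IsComponentOf.subset (h : IsComponentOf V F) : V ⊆ F := by
  obtain ⟨y, -, rfl⟩ := h
  exact connectedComponentIn_subset _ _

theorem IsComponentOf.nonempty (h : IsComponentOf V F) : V.Nonempty := by
  obtain ⟨y, hy, rfl⟩ := h
  exact ⟨y, mem_connectedComponentIn hy⟩

theorem IsComponentOf.isOpen [LocallyConnectedSpace Y] (h : IsComponentOf V F) (hF : IsOpen F) :
    IsOpen V := by
  obtain ⟨y, -, rfl⟩ := h
  exact hF.connectedComponentIn

theorem IsComponentOf.subset_of_isPreconnected (h : IsComponentOf V F) {S : Set Y}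
    (hS : IsPreconnected S) (hSF : S ⊆ F) (hSV : (S ∩ V).Nonempty) : S ⊆ V := by
  obtain ⟨y, -, rfl⟩ := h
  obtain ⟨z, hzS, hzV⟩ := hSV
  rw [connectedComponentIn_eq hzV]
  exact hS.subset_connectedComponentIn hzS hSF

theorem IsComponentOf.eq_of_inter_nonempty (h : IsComponentOf V F) (h' : IsComponentOf V' F)
    (hne : (V ∩ V').Nonempty) : V = V' :=
  (h'.subset_of_isPreconnected h.isPreconnected h.subset hne).antisymm
    (h.subset_of_isPreconnected h'.isPreconnected h'.subset (inter_comm V V' ▸ hne))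

/-- Adding limit points to `V` keeps it connected, so maximality absorbs those lying in `F`. -/
theorem IsComponentOf.closure_inter_subset (h : IsComponentOf V F) : closure V ∩ F ⊆ V :=
  h.subset_of_isPreconnected (h.isPreconnected.subset_closure
    (subset_inter subset_closure h.subset) inter_subset_left) inter_subset_right
    (h.nonempty.mono fun _ hz => ⟨⟨subset_closure hz, h.subset hz⟩, hz⟩)

theorem IsComponentOf.smul {J : Type*} [Group J] [MulAction J Y] [ContinuousConstSMul J Y]
    (h : IsComponentOf V F) {g : J} (hg : g • F = F) : IsComponentOf (g • V) F := by
  obtain ⟨y, hy, rfl⟩ := h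
  refine ⟨g • y, hg ▸ smul_mem_smul_set hy, ?_⟩
  have := (Homeomorph.smul g).image_connectedComponentIn hy
  simp only [Homeomorph.smul_apply, image_smul, hg] at this
  exact this

/-- A neighbourhood of a non-empty closed set `A` meets every component of the complement of `A`. -/
theorem IsComponentOf.inter_nonempty [ConnectedSpace Y] [LocallyConnectedSpace Y] {A N : Set Y}
    (hA : IsClosed A) (hAne : A.Nonempty) (hN : IsOpen N) (hAN : A ⊆ N) (h : IsComponentOf V Aᶜ) :
    (V ∩ N).Nonempty := by
  by_contra hVN
  have hdisj : Disjoint V N := disjoint_iff_inter_eq_empty.2 (not_nonempty_iff_eq_empty.1 hVN)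
  -- If `V` missed the open set `N`, so would its closure. All limit points of `V` would then lie
  -- off `A`, hence in `V`.
  have hclosed : IsClosed V := by
    refine isClosed_of_closure_subset fun y hy => ?_
    have hyN : y ∉ N := fun hyN => (hdisj.closure_left hN).le_bot ⟨hy, hyN⟩
    exact h.closure_inter_subset ⟨hy, fun hyA => hyN (hAN hyA)⟩
  have huniv : V = univ := IsClopen.eq_univ ⟨hclosed, h.isOpen hA.isOpen_compl⟩ h.nonempty
  obtain ⟨a, ha⟩ := hAne
  exact h.subset (huniv ▸ mem_univ a) ha

end Component

end CoveringAction

/-! ### Simple connectivity, path lifting and translates -/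

namespace CoveringAction

/-- In a simply connected, locally path connected space, a component of the complement of a
closed set `A` meets every connected open neighbourhood of `A` in a connected set. -/
theorem IsComponentOf.isPreconnected_inter {Y : Type*} [TopologicalSpace Y]
    [SimplyConnectedSpace Y] [LocallyPathConnectedSpace Y] {V A N : Set Y} (hA : IsClosed A)
    (hAne : A.Nonempty) (hN : IsOpen N) (hAN : A ⊆ N) (hNc : IsPreconnected N)
    (h : IsComponentOf V Aᶜ) : IsPreconnected (V ∩ N) := by
  have hVA : closure V ⊆ V ∪ A := fun y hy => by
    by_cases hyA : y ∈ A
    · exact Or.inr hyA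
    · exact Or.inl (h.closure_inter_subset ⟨hy, hyA⟩)
  -- The limit points of `V` outside `V` lie in `A`, hence in `N`, so `V` may be replaced by its
  -- closure.
  have hopen : IsOpen (N ∪ Vᶜ) := by
    have : N ∪ Vᶜ = N ∪ (closure V)ᶜ := by
      ext y
      constructor
      · rintro (hy | hy)
        · exact Or.inl hy
        · by_cases hyN : y ∈ N
          · exact Or.inl hyN
          · exact Or.inr fun hyV => (hVA hyV).elim hy fun hyA => hyN (hAN hyA)
      · exact fun hy => hy.imp_right fun hy hyV => hy (subset_closure hyV)
    rw [this]
    exact hN.union isClosed_closure.isOpen_compl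
  obtain ⟨a, ha⟩ := hAne
  -- Outside `N`, the set `Vᶜ` is covered by the other components of `Aᶜ`, each of which meets the
  -- connected set `N`.
  have hconn : IsPreconnected (N ∪ Vᶜ) := by
    refine isPreconnected_of_forall a fun y hy => ?_
    by_cases hyN : y ∈ N
    · exact ⟨N, subset_union_left, hAN ha, hyN, hNc⟩
    have hyV : y ∉ V := hy.resolve_left hyN
    have hyA : y ∈ Aᶜ := fun hyA => hyN (hAN hyA)
    have hV' : IsComponentOf (connectedComponentIn Aᶜ y) Aᶜ := ⟨y, hyA, rfl⟩
    have hyV' := mem_connectedComponentIn hyA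
    refine ⟨connectedComponentIn Aᶜ y ∪ N, union_subset (fun z hz => Or.inr fun hzV => hyV ?_)
      subset_union_left, Or.inr (hAN ha), Or.inl hyV',
      hV'.isPreconnected.union' (hV'.inter_nonempty hA ⟨a, ha⟩ hN hAN) hNc⟩
    rwa [h.eq_of_inter_nonempty hV' ⟨z, hzV, hz⟩]
  have := SimplyConnectedSpace.isPreconnected_inter (h.isOpen hA.isOpen_compl) hopen
    h.isPreconnected hconn (by ext y; simp; tauto)
  rwa [inter_union_distrib_left, inter_compl_self, union_empty] at this

/-- If the fundamental group of a subspace `A` generates that of the base of a quotient covering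
map, then the translates of a point over `A` lie in one path component of the preimage of `A`. -/
theorem joinedIn_preimage_smul {E X G : Type*} [TopologicalSpace E] [TopologicalSpace X] [Group G]
    [MulAction G E] [PathConnectedSpace E] {p : E → X} (hp : IsQuotientCoveringMap p G)
    {A : Set X} {e : E} (he : p e ∈ A) (hA : PiOneImageGenerates A ⟨p e, he⟩) (g : G) :
    JoinedIn (p ⁻¹' A) e (g • e) := by
  let e' : p ⁻¹' {p e} := ⟨e, rfl⟩
  obtain ⟨γ, hγ⟩ := hp.fundamentalGroupToMulOpposite_surjective e' (MulOpposite.op g)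
  rw [hp.fundamentalGroupToMulOpposite_apply_eq_Iff] at hγ
  -- The image is already a subgroup, so generating means surjectivity: the loop with monodromy `g`
  -- can be taken inside `A`.
  rw [PiOneImageGenerates, ← MonoidHom.coe_range, Subgroup.closure_eq] at hA
  obtain ⟨δ, rfl⟩ := MonoidHom.range_eq_top.1 hA γ
  induction δ using Path.Homotopic.Quotient.ind with | mk δ =>
  let δ' : Path (p e) (p e) := δ.map (f := Subtype.val) continuous_subtype_val
  have hδ : (δ' : C(unitInterval, X)) 0 = p e := δ'.source
  let Γ := hp.isCoveringMap.liftPath δ' e hδ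
  have hΓ : Γ 1 = g • e := hγ.symm
  refine ⟨⟨Γ, hp.isCoveringMap.liftPath_zero δ' e hδ, hΓ⟩, fun t => ?_⟩
  have : p (Γ t) = δ t := congrFun (hp.isCoveringMap.liftPath_lifts δ' e hδ) t
  change p (Γ t) ∈ A
  rw [this]
  exact (δ t).2

section Action

variable {J Y : Type*} [Group J] [MulAction J Y]

theorem mem_translates {A : Set Y} {y : Y} : y ∈ translates J A ↔ ∃ g : J, y ∈ g • A :=
  mem_iUnion

theorem subset_translates (A : Set Y) : A ⊆ translates J A := fun _ hy =>
  mem_translates.2 ⟨1, by simpa⟩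

theorem smul_translates (A : Set Y) (g : J) : g • translates J A = translates J A := by
  have key (g : J) : g • translates J A ⊆ translates J A := by
    rintro _ ⟨y, hy, rfl⟩
    obtain ⟨h, hy⟩ := mem_translates.1 hy
    exact mem_translates.2 ⟨g * h, mul_smul g h A ▸ smul_mem_smul_set hy⟩
  exact (key g).antisymm (subset_smul_set_iff.2 (key g⁻¹))

theorem preimage_proj_image (A : Set Y) : proj J ⁻¹' (proj J '' A) = translates J A := by
  ext y
  simp only [mem_preimage, mem_image, mem_translates]
  constructor
  · rintro ⟨a, ha, hay⟩
    obtain ⟨g, hg⟩ := MulAction.orbitRel_apply.1 (Quotient.exact hay)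
    exact ⟨g⁻¹, a, ha, by simp [← hg]⟩
  · rintro ⟨g, a, ha, rfl⟩
    exact ⟨a, ha, Quotient.sound (MulAction.orbitRel_apply.2 ⟨g⁻¹, by simp⟩)⟩

/-- For a point `a` of `A`, a path from `a` to `g • a` over `proj J '' A` stays in `translates J A`
and links `a` to the connected set `g • A`. -/
theorem isPreconnected_translates [TopologicalSpace Y] [PathConnectedSpace Y]
    (hcov : ActsByCoveringTransformations J Y) {A : Set Y} (hA : IsPreconnected A)
    {x : proj J '' A} (hgen : PiOneImageGenerates (proj J '' A) x) :
    IsPreconnected (translates J A) := by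
  have := hcov.toContinuousConstSMul
  obtain ⟨_, a, ha, rfl⟩ := x
  refine isPreconnected_of_forall a fun y hy => ?_
  obtain ⟨g, hy⟩ := mem_translates.1 hy
  obtain ⟨γ, hγ⟩ := joinedIn_preimage_smul (p := proj J) hcov _ hgen g
  refine ⟨range γ ∪ g • A, union_subset ?_ (subset_iUnion (fun g : J => g • A) g), Or.inl ⟨0, γ.source⟩, Or.inr hy,
    (isPreconnected_range γ.continuous).union (g • a) ⟨1, γ.target⟩ (smul_mem_smul_set ha)
      (hA.image _ (continuous_const_smul g).continuousOn)⟩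
  rintro _ ⟨t, rfl⟩
  exact preimage_proj_image (J := J) A ▸ hγ t

/-- A neighbourhood with pairwise disjoint translates contains `g • y` for at most one `g`; finitely
many such neighbourhoods cover `K`. -/
theorem finite_setOf_smul_mem [TopologicalSpace Y] (hcov : ActsByCoveringTransformations J Y) {K : Set Y}
    (hK : IsCompact K) (y : Y) : {g : J | g • y ∈ K}.Finite := by
  refine hK.induction_on (p := fun s => {g : J | g • y ∈ s}.Finite) (by simp)
    (fun s t hst ht => ht.subset fun g hg => hst hg)
    (fun s t hs ht => (hs.union ht).subset fun g hg => hg) fun z _ => ?_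
  obtain ⟨U, hU, hdisj⟩ := hcov.disjoint z
  refine ⟨U, mem_nhdsWithin_of_mem_nhds hU, Set.Subsingleton.finite fun g hg h hh => ?_⟩
  exact (mul_inv_eq_one.1 (hdisj (h * g⁻¹) ⟨h • y, ⟨g • y, hg, by simp [mul_smul]⟩, hh⟩)).symm

end Action

end CoveringAction

/-! ### Cells, local finiteness and the action on cells -/

namespace CoveringAction

open RelCWComplex

section Cells

variable {Y : Type*} [TopologicalSpace Y] [CWComplex (univ : Set Y)]

theorem exists_mem_openCell (y : Y) :
    ∃ c : Σ n, cell (univ : Set Y) n, y ∈ openCell c.1 c.2 := by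
  have : y ∈ ⋃ (n : ℕ) (j : cell (univ : Set Y) n), openCell n j := by
    rw [CWComplex.iUnion_openCell_eq_complex]
    exact mem_univ y
  simp only [mem_iUnion] at this
  obtain ⟨n, j, h⟩ := this
  exact ⟨⟨n, j⟩, h⟩

theorem isPreconnected_openCell (c : Σ n, cell (univ : Set Y) n) :
    IsPreconnected (openCell c.1 c.2) :=
  (convex_ball _ _).isPreconnected.image _
    ((RelCWComplex.continuousOn c.1 c.2).mono Metric.ball_subset_closedBall)

/-- An open cell meeting a subcomplex lies in it. -/
theorem openCell_subset_of_inter_nonempty [T2Space Y] (D : CWComplex.Subcomplex (univ : Set Y))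
    {n : ℕ} {j : cell (univ : Set Y) n} (h : (openCell n j ∩ D).Nonempty) :
    openCell n j ⊆ (D : Set Y) := by
  by_cases hj : j ∈ D.I n
  · exact CWComplex.Subcomplex.openCell_subset_of_mem D hj
  · exact absurd (CWComplex.Subcomplex.disjoint_openCell_subcomplex_of_not_mem D hj)
      (not_disjoint_iff_nonempty_inter.2 h)

theorem isCompact_of_finite [T2Space Y] (D : CWComplex.Subcomplex (univ : Set Y))
    (hD : CWComplex.Finite (D : Set Y)) : IsCompact (D : Set Y) := by
  have hfin : Finite (Σ n, cell (D : Set Y) n) := RelCWComplex.finite_cells_of_finite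
  have : (D : Set Y) = ⋃ c : Σ n, cell (D : Set Y) n, closedCell c.1 c.2 := by
    rw [iUnion_sigma]
    exact (CWComplex.union (C := (D : Set Y))).symm
  rw [this]
  exact isCompact_iUnion fun c => isCompact_closedCell

/-- A compact connected subset of a locally finite CW complex has a connected open neighbourhood
that meets only finitely many cells. -/
theorem exists_isOpen_isPreconnected_finite_cells [LocallyConnectedSpace Y]
    (hlf : LocallyFiniteCW Y) {K : Set Y} (hK : IsCompact K) (hKc : IsConnected K) :
    ∃ W, IsOpen W ∧ IsPreconnected W ∧ K ⊆ W ∧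
      {c : Σ n, cell (univ : Set Y) n | (openCell c.1 c.2 ∩ W).Nonempty}.Finite := by
  obtain ⟨W, hW, hKW, hfin⟩ : ∃ W, IsOpen W ∧ K ⊆ W ∧
      {c : Σ n, cell (univ : Set Y) n | (openCell c.1 c.2 ∩ W).Nonempty}.Finite := by
    refine hK.induction_on ⟨∅, isOpen_empty, Subset.rfl, by simp⟩
      (fun s t hst ⟨W, hW, htW, h⟩ => ⟨W, hW, hst.trans htW, h⟩)
      (fun s t ⟨W, hW, hsW, h⟩ ⟨W', hW', htW', h'⟩ => ⟨W ∪ W', hW.union hW',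
        union_subset_union hsW htW', (h.union h').subset fun c hc => ?_⟩) fun y _ => ?_
    · rw [mem_ofPred, inter_union_distrib_left, union_nonempty] at hc
      exact hc
    · obtain ⟨t, ht, hfin⟩ := hlf y
      obtain ⟨W, hWt, hW, hyW⟩ := mem_nhds_iff.1 ht
      exact ⟨W, mem_nhdsWithin_of_mem_nhds (hW.mem_nhds hyW), W, hW, Subset.rfl,
        hfin.subset fun c hc => hc.mono (inter_subset_inter (openCell_subset_closedCell _ _) hWt)⟩
  obtain ⟨y, hy⟩ := hKc.nonempty
  exact ⟨connectedComponentIn W y, hW.connectedComponentIn, isPreconnected_connectedComponentIn,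
    hKc.isPreconnected.subset_connectedComponentIn hy hKW,
    hfin.subset fun c hc => hc.mono (inter_subset_inter_right _ (connectedComponentIn_subset _ _))⟩

end Cells

section CellAction

variable {J Y : Type*} [Group J] [TopologicalSpace Y] [CWComplex (univ : Set Y)]
  [MulAction J Y]

/-- The translates of a subcomplex form a closed set. -/
theorem isClosed_translates [T2Space Y] (hcov : ActsByCoveringTransformations J Y)
    (hcell : CellPreserving J Y) (hlf : LocallyFiniteCW Y)
    (D : CWComplex.Subcomplex (univ : Set Y)) : IsClosed (translates J (D : Set Y)) := by
  have := hcov.toContinuousConstSMul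
  let S : Set (Σ n, cell (univ : Set Y) n) := {c | closedCell c.1 c.2 ⊆ translates J (D : Set Y)}
  -- As a union of closed cells, the set is closed by local finiteness.
  have hS : translates J (D : Set Y) = ⋃ c : S, closedCell c.1.1 c.1.2 := by
    refine Subset.antisymm (fun y hy => ?_) (iUnion_subset fun c => c.2)
    obtain ⟨g, z, hz, rfl⟩ := mem_translates.1 hy
    obtain ⟨⟨n, j⟩, hzj⟩ := exists_mem_openCell z
    obtain ⟨k, hk⟩ := hcell g n j
    have hjD : closedCell n j ⊆ (D : Set Y) := by
      rw [← closure_openCell_eq_closedCell]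
      exact closure_minimal (openCell_subset_of_inter_nonempty D ⟨z, hzj, hz⟩) D.closed
    have hkS : closedCell n k ⊆ translates J (D : Set Y) := by
      rw [← closure_openCell_eq_closedCell, ← hk, closure_smul, closure_openCell_eq_closedCell]
      exact (smul_set_mono hjD).trans (subset_iUnion (fun g : J => g • (D : Set Y)) g)
    refine mem_iUnion.2 ⟨⟨⟨n, k⟩, hkS⟩, openCell_subset_closedCell n k ?_⟩
    change g • z ∈ openCell n k
    rw [← hk]
    exact smul_mem_smul_set hzj
  rw [hS]
  exact (hlf.comp_injective Subtype.val_injective).isClosed_iUnion fun c => isClosed_closedCell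

/-- An open cell meeting the translates of a subcomplex lies in their union. -/
theorem openCell_subset_translates [T2Space Y] (hcell : CellPreserving J Y)
    (D : CWComplex.Subcomplex (univ : Set Y)) {n : ℕ} {j : cell (univ : Set Y) n}
    (h : (openCell n j ∩ translates J (D : Set Y)).Nonempty) :
    openCell n j ⊆ translates J (D : Set Y) := by
  obtain ⟨y, hyj, hy⟩ := h
  obtain ⟨g, hg⟩ := mem_translates.1 hy
  obtain ⟨k, hk⟩ := hcell g⁻¹ n j
  have hkD : openCell n k ⊆ (D : Set Y) := openCell_subset_of_inter_nonempty D
    ⟨g⁻¹ • y, hk ▸ smul_mem_smul_set hyj, mem_smul_set_iff_inv_smul_mem.1 hg⟩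
  rw [← hk, smul_set_subset_iff_subset_inv_smul_set, inv_inv] at hkD
  exact hkD.trans (subset_iUnion (fun g : J => g • (D : Set Y)) g)

/-- A set meeting only finitely many cells meets only finitely many of its translates. -/
theorem finite_setOf_smul_inter_nonempty (hcov : ActsByCoveringTransformations J Y)
    (hcell : CellPreserving J Y) {W : Set Y}
    (hW : {c : Σ n, cell (univ : Set Y) n | (openCell c.1 c.2 ∩ W).Nonempty}.Finite) :
    {g : J | (g • W ∩ W).Nonempty}.Finite := by
  -- One sample point per open cell suffices: if `g` carries a point of `W` in cell `c` to a point
  -- of `W` in cell `c'`, it carries all of `c` onto `c'`, so `g • y c` lies in the compact closed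
  -- cell of `c'`.
  choose y hy using fun c : Σ n, cell (univ : Set Y) n => openCell_nonempty c.1 c.2
  refine (hW.biUnion fun c _ => hW.biUnion fun c' _ => finite_setOf_smul_mem hcov
    (isCompact_closedCell (n := c'.1) (i := c'.2)) (y c)).subset ?_
  rintro g ⟨_, ⟨w, hw, rfl⟩, hgw⟩
  obtain ⟨⟨n, j⟩, hj⟩ := exists_mem_openCell w
  obtain ⟨k, hk⟩ := hcell g n j
  have hgk {z : Y} (hz : z ∈ openCell n j) : g • z ∈ openCell n k := hk ▸ smul_mem_smul_set hz
  exact mem_iUnion₂.2 ⟨⟨n, j⟩, ⟨w, hj, hw⟩, mem_iUnion₂.2 ⟨⟨n, k⟩, ⟨g • w, hgk hj, hgw⟩,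
    openCell_subset_closedCell n k (hgk (hy ⟨n, j⟩))⟩⟩

end CellAction

end CoveringAction

/-! ### The stabilizer of a complementary component -/

theorem theorem6p1 {J : Type*} [Group J] (hJ : Group.FG J)
    {Y : Type*} [TopologicalSpace Y] [T2Space Y] [CWComplex (Set.univ : Set Y)]
    [SimplyConnectedSpace Y]
    (hend : CoveringAction.OneEnded Y)
    (hdim : CoveringAction.DimensionLE Y 2)
    (hlf : CoveringAction.LocallyFiniteCW Y)
    [MulAction J Y]
    (hcov : CoveringAction.ActsByCoveringTransformations J Y)
    (hcell : CoveringAction.CellPreserving J Y)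
    (D : CWComplex.Subcomplex (Set.univ : Set Y))
    (hDfin : CWComplex.Finite (D : Set Y))
    (hDconn : IsConnected (D : Set Y))
    (x : CoveringAction.proj J '' (D : Set Y))
    (hgen : CoveringAction.PiOneImageGenerates (CoveringAction.proj J '' (D : Set Y)) x)
    (V : Set Y)
    (hV : CoveringAction.IsComponentOf V (CoveringAction.translates J (D : Set Y))ᶜ)
    (hVunb : CoveringAction.JUnbounded J V) :
    (MulAction.stabilizer J V).FG := by
  open CoveringAction RelCWComplex in
  have := hcov.toContinuousConstSMul
  have := CWComplex.locallyPathConnectedSpace Y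
  set A : Set Y := translates J (D : Set Y)
  have hAne : A.Nonempty := hDconn.nonempty.mono (subset_translates _)
  have hA : IsClosed A := isClosed_translates hcov hcell hlf D
  have hAc : IsPreconnected A := isPreconnected_translates hcov hDconn.isPreconnected hgen
  have hgV (g : J) : IsComponentOf (g • V) Aᶜ :=
    hV.smul (by rw [Set.smul_set_compl, smul_translates])
  obtain ⟨W, hW, hWc, hDW, hWfin⟩ :=
    exists_isOpen_isPreconnected_finite_cells hlf (isCompact_of_finite D hDfin) hDconn
  set N : Set Y := translates J W
  have hAN : A ⊆ N := iUnion_mono fun g => smul_set_mono hDW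
  have hN : IsOpen N := isOpen_iUnion fun g => hW.smul g
  have hNc : IsPreconnected N := by
    obtain ⟨d, hd⟩ := hDconn.nonempty
    -- Each `g • W` is connected and meets the connected set `A`, since it contains `g • D`.
    refine isPreconnected_of_forall d fun y hy => ?_
    obtain ⟨g, hg⟩ := mem_translates.1 hy
    exact ⟨A ∪ g • W, union_subset hAN (subset_iUnion (fun g : J => g • W) g),
      Or.inl (subset_translates _ hd), Or.inr hg,
      hAc.union (g • d) (mem_translates.2 ⟨g, smul_mem_smul_set hd⟩)
        (smul_mem_smul_set (hDW hd)) (hWc.image _ (continuous_const_smul g).continuousOn)⟩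
  classical
  -- finitely many translates of `W` represent all intersections of `V` with translates of `W`
  let h (c : Σ n, cell (univ : Set Y) n) : J :=
    -- The default `1`, for cells lying in no translate of `V`, is harmless: it can only enlarge the
    -- finite set `T`.
    if hc : ∃ g : J, openCell c.1 c.2 ⊆ g • V then hc.choose else 1
  let T : Set J := h '' {c | (openCell c.1 c.2 ∩ W).Nonempty}
  have hT : T.Finite := hWfin.image h
  let U : Set Y := ⋃ k ∈ T, k⁻¹ • W ∩ V
  have hUopen : IsOpen U :=
    isOpen_biUnion fun k _ => (hW.smul k⁻¹).inter (hV.isOpen hA.isOpen_compl)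
  have hUV : U ⊆ V := iUnion₂_subset fun k _ => inter_subset_right
  have hUnion : ⋃ g : MulAction.stabilizer J V, g • U = V ∩ N := by
    refine Subset.antisymm (iUnion_subset fun g => ?_) fun y hy => ?_
    · rintro _ ⟨u, hu, rfl⟩
      refine ⟨(MulAction.mem_stabilizer_iff.1 g.2).subset (smul_mem_smul_set (hUV hu)), ?_⟩
      obtain ⟨k, -, huk, -⟩ := mem_iUnion₂.1 hu
      exact mem_translates.2 ⟨g.1 * k⁻¹, mul_smul g.1 k⁻¹ W ▸ smul_mem_smul_set huk⟩
    · obtain ⟨g, w, hw, rfl⟩ := mem_translates.1 hy.2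
      obtain ⟨c, hc⟩ := exists_mem_openCell w
      have hwV : w ∈ g⁻¹ • V := mem_inv_smul_set_iff.2 hy.1
      have hcA : openCell c.1 c.2 ⊆ Aᶜ := fun z hz hzA => (hgV g⁻¹).subset hwV
        (openCell_subset_translates hcell D ⟨z, hz, hzA⟩ hc)
      have hex : ∃ g : J, openCell c.1 c.2 ⊆ g • V :=
        ⟨g⁻¹, (hgV g⁻¹).subset_of_isPreconnected (isPreconnected_openCell c) hcA ⟨w, hc, hwV⟩⟩
      have hwk : w ∈ h c • V := by
        have : h c = hex.choose := dif_pos hex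
        rw [this]
        exact hex.choose_spec hc
      -- Both translates of `V` are components of `Aᶜ` containing `w`, so they agree and `g * h c`
      -- stabilizes `V`. It carries `(h c)⁻¹ • w`, a point of `U`, to `g • w`.
      have heq : g⁻¹ • V = h c • V := (hgV _).eq_of_inter_nonempty (hgV _) ⟨w, hwV, hwk⟩
      have hmem : g * h c ∈ MulAction.stabilizer J V := by
        rw [MulAction.mem_stabilizer_iff, mul_smul, ← heq, smul_inv_smul]
      refine mem_iUnion.2 ⟨⟨_, hmem⟩, (h c)⁻¹ • w, mem_iUnion₂.2 ⟨h c, ⟨c, ⟨w, hc, hw⟩, rfl⟩,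
        smul_mem_smul_set hw, mem_smul_set_iff_inv_smul_mem.1 hwk⟩, ?_⟩
      change (g * h c) • (h c)⁻¹ • w = g • w
      rw [mul_smul, smul_inv_smul]
  have hne : (V ∩ N).Nonempty := hV.inter_nonempty hA hAne hN hAN
  have hUne : U.Nonempty := by
    obtain ⟨y, hy⟩ := hne
    rw [← hUnion] at hy
    obtain ⟨g, u, hu, -⟩ := mem_iUnion.1 hy
    exact ⟨u, hu⟩
  rw [← Group.fg_iff_subgroup_fg]
  have : ContinuousConstSMul (MulAction.stabilizer J V) Y := ⟨fun g => continuous_const_smul g.1⟩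
  refine Group.fg_of_isPreconnected_iUnion_smul hUopen hUne ?_ ?_
  · rw [hUnion]
    exact hV.isPreconnected_inter hA hAne hN hAN hNc
  · have hfinW := finite_setOf_smul_inter_nonempty hcov hcell hWfin
    refine Set.Finite.of_finite_image (f := Subtype.val) ?_ Subtype.val_injective.injOn
    -- If `u ∈ k⁻¹ • W` and `g • u ∈ k'⁻¹ • W`, then `k' * g * k⁻¹` moves `W` to meet itself, which
    -- leaves finitely many `g` for each of the finitely many pairs `k`, `k'`.
    refine (hT.biUnion fun k _ => hT.biUnion fun k' _ =>
      hfinW.image fun g => k'⁻¹ * g * k).subset ?_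
    rintro _ ⟨g, ⟨_, ⟨u, hu, rfl⟩, hgu⟩, rfl⟩
    obtain ⟨k, hk, hku, -⟩ := mem_iUnion₂.1 hu
    obtain ⟨k', hk', hku', -⟩ := mem_iUnion₂.1 hgu
    refine mem_iUnion₂.2 ⟨k, hk, mem_iUnion₂.2 ⟨k', hk', k' * g.1 * k⁻¹,
      ⟨k' • g.1 • u, ⟨k • u, mem_inv_smul_set_iff.1 hku, ?_⟩, mem_inv_smul_set_iff.1 hku'⟩, ?_⟩⟩
    · simp [mul_smul]
    · simp [mul_assoc]
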